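/- **Theorem (Definability Theorem).** Let $\mathrm{AP}$ be an infinite set of atomic propositions, and let $\mathcal L$ be the set of formulas built from $\mathrm{AP}$ with $\bot,\wedge,\vee,\to$. Let $\chi\in\mathcal L$ be a formula in which no atom other than $p$ occurs. *Index.* Put $\chi^0:=p$ and $\chi^{k+1}:=\chi[\chi^{k}/p]$. Let $n$ be the index of $\chi$, i.e. the least number such that $\chi^{n}\leftrightarrow\chi^{n+2}$ is provable in the intuitionistic propositional calculus (it exists by Ruitenburg's theorem). *Core and $\chi$-validity.* For a Heyting algebra $H$ let $\boldsymbol\chi:H\to H$ be the polynomial $a\mapsto[\![\chi]\!]^H_{[p\mapsto a]}$, and call $H^\chi:=\boldsymbol\chi^{n}[H]$ the $\chi$-core of $H$. The algebra $H$ *$\chi$-validates* $\phi\in\mathcal L$, written $H\vDash^\chi\phi$, if $[\![\phi]\!]^H_V=1$ for every valuation $V:\mathrm{AP}\to H$ with $V[\mathrm{AP}]\subseteq H^\chi$. It $\chi$-validates a set of formulas if it $\chi$-validates each member. *$\chi$-varieties.* A variety is a class of Heyting algebras closed under homomorphic images, (isomorphic copies of) subalgebras, and arbitrary products, including the empty product.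 The $\chi$-closure of a variety $\mathcal V$ is the class $\mathcal V^\chi$ of all Heyting algebras $K$ for which some $H\in\mathcal V$ is a subalgebra of $K$ with $H^\chi=K^\chi$. A $\chi$-variety is a class of the form $\mathcal V^\chi$ for some variety $\mathcal V$. For a class $\mathcal C$ of Heyting algebras and a set $\Gamma\subseteq\mathcal L$ put $$\mathsf{Log}^\chi(\mathcal C):=\{\phi\in\mathcal L : H\vDash^\chi\phi\text{ for all }H\in\mathcal C\},\qquad \mathsf{Var}^\chi(\Gamma):=\{H : H\vDash^\chi\Gamma\}.$$ Then every $\chi$-variety $\mathcal X$ is defined by its $\chi$-validities: for every Heyting algebra $H$, $$H\in\mathcal X\iff H\vDash^\chi\mathsf{Log}^\chi(\mathcal X).$$ That is, $\mathsf{Var}^\chi(\mathsf{Log}^\chi(\mathcal X))=\mathcal X$ for every $\chi$-variety $\mathcal X$, so $\mathsf{Var}^\chi\circ\mathsf{Log}^\chi$ is the identity on $\chi$-varieties. -/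

import Mathlib

universe u v

namespace ChiLogic

/-- Propositional formulas over the set `AP` of atomic propositions. -/
inductive Formula (AP : Type v) : Type v
  | atom : AP → Formula AP
  | bot : Formula AP
  | and : Formula AP → Formula AP → Formula AP
  | or : Formula AP → Formula AP → Formula AP
  | imp : Formula AP → Formula AP → Formula AP

namespace Formula

variable {AP : Type v}

/-- The biconditional, as a shorthand. -/
def iff (φ ψ : Formula AP) : Formula AP := and (imp φ ψ) (imp ψ φ)

/-- The set of atomic propositions that occur in a formula. -/
def atoms : Formula AP → Set AP
  | atom q => {q}
  | bot => ∅
  | and φ ψ => atoms φ ∪ atoms ψ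
  | or φ ψ => atoms φ ∪ atoms ψ
  | imp φ ψ => atoms φ ∪ atoms ψ

/-- Simultaneous substitution of `s q` for every atom `q`. -/
def subst (s : AP → Formula AP) : Formula AP → Formula AP
  | atom q => s q
  | bot => bot
  | and φ ψ => and (subst s φ) (subst s ψ)
  | or φ ψ => or (subst s φ) (subst s ψ)
  | imp φ ψ => imp (subst s φ) (subst s ψ)

open Classical in
/-- `χ[ψ/p]`: every occurrence of the atom `p` in `χ` is replaced by `ψ`. -/
noncomputable def substOne (χ : Formula AP) (p : AP) (ψ : Formula AP) : Formula AP :=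
  χ.subst (Function.update atom p ψ)

/-- The formulas `χ⁰ = p` and `χᵏ⁺¹ = χ[χᵏ/p]`. -/
noncomputable def iter (χ : Formula AP) (p : AP) : ℕ → Formula AP
  | 0 => atom p
  | k + 1 => χ.substOne p (iter χ p k)

/-- The interpretation of a formula in a Heyting algebra under a valuation. -/
def eval {H : Type u} [HeytingAlgebra H] (V : AP → H) : Formula AP → H
  | atom q => V q
  | bot => ⊥
  | and φ ψ => eval V φ ⊓ eval V ψ
  | or φ ψ => eval V φ ⊔ eval V ψ
  | imp φ ψ => eval V φ ⇨ eval V ψ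

end Formula

/-- Provability in the intuitionistic propositional calculus, as a Hilbert system. -/
inductive IPC {AP : Type v} : Formula AP → Prop
  | k (φ ψ : Formula AP) : IPC (.imp φ (.imp ψ φ))
  | s (φ ψ θ : Formula AP) :
      IPC (.imp (.imp φ (.imp ψ θ)) (.imp (.imp φ ψ) (.imp φ θ)))
  | andLeft (φ ψ : Formula AP) : IPC (.imp (.and φ ψ) φ)
  | andRight (φ ψ : Formula AP) : IPC (.imp (.and φ ψ) ψ)
  | andIntro (φ ψ : Formula AP) : IPC (.imp φ (.imp ψ (.and φ ψ)))
  | orLeft (φ ψ : Formula AP) : IPC (.imp φ (.or φ ψ))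
  | orRight (φ ψ : Formula AP) : IPC (.imp ψ (.or φ ψ))
  | orElim (φ ψ θ : Formula AP) :
      IPC (.imp (.imp φ θ) (.imp (.imp ψ θ) (.imp (.or φ ψ) θ)))
  | exFalso (φ : Formula AP) : IPC (.imp .bot φ)
  | mp {φ ψ : Formula AP} : IPC φ → IPC (.imp φ ψ) → IPC ψ

/-- The Ruitenburg index of `χ` with respect to the atom `p`: the least `n` such that
`χⁿ ↔ χⁿ⁺²` is provable in `IPC` (such an `n` exists, by Ruitenburg's theorem). -/
noncomputable def index {AP : Type v} (p : AP) (χ : Formula AP) : ℕ :=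
  sInf {n : ℕ | IPC ((χ.iter p n).iff (χ.iter p (n + 2)))}

/-- The unary polynomial `a ↦ ⟦χ⟧_[p ↦ a]` of a formula `χ` that has no atom besides `p`
(the value of the valuation at the other atoms is irrelevant). -/
def poly {AP : Type v} (χ : Formula AP) (H : Type u) [HeytingAlgebra H] (a : H) : H :=
  χ.eval (fun _ => a)

/-- The `χ`-core of `H`: the image of `H` under the `n`-th iterate of the polynomial of `χ`,
where `n` is the index of `χ`. -/
def core {AP : Type v} (p : AP) (χ : Formula AP) (H : Type u) [HeytingAlgebra H] : Set H :=
  Set.range ((poly χ H)^[index p χ])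

/-- `H ⊨^χ φ`: the formula `φ` is true in `H` under every valuation with values in the core. -/
def ChiValid {AP : Type v} (p : AP) (χ : Formula AP) (H : Type u) [HeytingAlgebra H]
    (φ : Formula AP) : Prop :=
  ∀ V : AP → H, (∀ q, V q ∈ core p χ H) → φ.eval V = ⊤

/-- The class of homomorphic images of members of `C`. -/
def homImages (C : Set HeytAlg.{u}) : Set HeytAlg.{u} :=
  {H | ∃ A ∈ C, ∃ f : HeytingHom A H, Function.Surjective f}

/-- The class of algebras that embed into a member of `C`. -/
def subalgebras (C : Set HeytAlg.{u}) : Set HeytAlg.{u} :=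
  {H | ∃ A ∈ C, ∃ f : HeytingHom H A, Function.Injective f}

/-- The class of products of families of members of `C` (the empty family included). -/
def products (C : Set HeytAlg.{u}) : Set HeytAlg.{u} :=
  {H | ∃ (I : Type u) (A : I → HeytAlg.{u}), (∀ i, A i ∈ C) ∧ H = HeytAlg.of (∀ i, A i)}

/-- A variety of Heyting algebras. -/
def IsVariety (C : Set HeytAlg.{u}) : Prop :=
  homImages C ⊆ C ∧ subalgebras C ⊆ C ∧ products C ⊆ C

/-- `K` is a core superalgebra of `H`: `H` is, up to an embedding, a subalgebra of `K`, with
the same core. -/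
def IsCoreSuperalgebra {AP : Type v} (p : AP) (χ : Formula AP) (K H : HeytAlg.{u}) : Prop :=
  ∃ f : HeytingHom H K, Function.Injective f ∧ f '' core p χ H = core p χ K

/-- The `χ`-closure of a class: all core superalgebras of its members. -/
def chiClosure {AP : Type v} (p : AP) (χ : Formula AP) (C : Set HeytAlg.{u}) :
    Set HeytAlg.{u} :=
  {K | ∃ H ∈ C, IsCoreSuperalgebra p χ K H}

/-- A `χ`-variety is the `χ`-closure of a variety. -/
def IsChiVariety {AP : Type v} (p : AP) (χ : Formula AP) (X : Set HeytAlg.{u}) : Prop :=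
  ∃ C : Set HeytAlg.{u}, IsVariety C ∧ X = chiClosure p χ C

/-- The set of formulas that are `χ`-valid in all members of a class. -/
def chiLog {AP : Type v} (p : AP) (χ : Formula AP) (C : Set HeytAlg.{u}) :
    Set (Formula AP) :=
  {φ | ∀ H ∈ C, ChiValid p χ H φ}

/-- The class of Heyting algebras that `χ`-validate a set of formulas. -/
def chiVar {AP : Type v} (p : AP) (χ : Formula AP) (Γ : Set (Formula AP)) :
    Set HeytAlg.{u} :=
  {H | ∀ φ ∈ Γ, ChiValid p χ H φ}

end ChiLogic

/-! Core valuations in a core superalgebra come from core valuations below, so a variety `C` and its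
`χ`-closure have the same `χ`-logic. Given `H` validating that logic, let `A` be the subalgebra
generated by its core. Applying `χⁿ` twice fixes core elements, so `A` has the same core as `H`
(`image_core_eq`), and it remains to see that `A` is in `C`. This is Birkhoff's argument
(`evalRange_mem_of_chiLog`): each formula refuted by the generators of `A` is refuted at core
elements of some member of `C`; in the product of these members, the tuples of refuting values
generate a subalgebra that maps onto `A`. -/

namespace ChiLogic

namespace Formula

/-- Renaming of the atoms of a formula along a map. -/
def rename {α : Type*} {β : Type*} (r : α → β) : Formula α → Formula β
  | atom q => atom (r q)
  | bot => bot
  | and φ ψ => and (rename r φ) (rename r ψ)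
  | or φ ψ => or (rename r φ) (rename r ψ)
  | imp φ ψ => imp (rename r φ) (rename r ψ)

theorem finite_atoms {α : Type*} (φ : Formula α) : φ.atoms.Finite := by
  induction φ with
  | atom q => exact Set.finite_singleton q
  | bot => exact Set.finite_empty
  | and φ ψ h₁ h₂ => exact h₁.union h₂
  | or φ ψ h₁ h₂ => exact h₁.union h₂
  | imp φ ψ h₁ h₂ => exact h₁.union h₂

section Eval

variable {α : Type*} {β : Type*} {H : Type*} [HeytingAlgebra H] {K : Type*} [HeytingAlgebra K]

theorem eval_congr {V W : α → H} {φ : Formula α} (h : ∀ q ∈ φ.atoms, V q = W q) :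
    φ.eval V = φ.eval W := by
  induction φ with
  | atom q => exact h q rfl
  | bot => rfl
  | and φ ψ h₁ h₂ | or φ ψ h₁ h₂ | imp φ ψ h₁ h₂ =>
    simp only [eval, h₁ fun q hq => h q (Or.inl hq), h₂ fun q hq => h q (Or.inr hq)]

theorem eval_rename (r : α → β) (V : β → H) (φ : Formula α) :
    (φ.rename r).eval V = φ.eval (V ∘ r) := by
  induction φ <;> simp_all [rename, eval]

theorem eval_subst (s : α → Formula α) (V : α → H) (φ : Formula α) :
    (φ.subst s).eval V = φ.eval fun q => (s q).eval V := by
  induction φ <;> simp_all [subst, eval]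

theorem map_eval (f : HeytingHom H K) (V : α → H) (φ : Formula α) :
    f (φ.eval V) = φ.eval fun q => f (V q) := by
  induction φ <;> simp_all [eval]

/-- Reduces equations between values to the truth of one formula. -/
theorem eval_iff_eq_top (V : α → H) (φ ψ : Formula α) :
    (φ.iff ψ).eval V = ⊤ ↔ φ.eval V = ψ.eval V := by
  simp only [iff, eval, inf_eq_top_iff, himp_eq_top_iff]
  exact ⟨fun h => le_antisymm h.1 h.2, fun h => ⟨h.le, h.ge⟩⟩

theorem eval_pi {ι : Type*} {B : ι → Type*} [∀ i, HeytingAlgebra (B i)] (V : α → ∀ i, B i)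
    (φ : Formula α) (i : ι) : φ.eval V i = φ.eval fun q => V q i := by
  induction φ <;> simp_all [eval]

/-- The iterates of `χ` are interpreted as the iterates of its polynomial. -/
theorem eval_iter {p : α} {χ : Formula α} (hχ : χ.atoms ⊆ {p}) (V : α → H) (k : ℕ) :
    (χ.iter p k).eval V = (poly χ H)^[k] (V p) := by
  induction k with
  | zero => rfl
  | succ k ih =>
    rw [Function.iterate_succ_apply', ← ih, iter, substOne, eval_subst, poly]
    refine eval_congr fun q hq => ?_
    obtain rfl : q = p := hχ hq
    simp

end Eval

end Formula

open Formula

/-- Soundness of the intuitionistic propositional calculus for Heyting algebras. -/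
theorem IPC.sound {α : Type*} {φ : Formula α} (h : IPC φ) {H : Type*} [HeytingAlgebra H]
    (V : α → H) : φ.eval V = ⊤ := by
  induction h with
  | k φ ψ => simp [eval]
  | s φ ψ θ =>
    simp only [eval, himp_eq_top_iff, le_himp_iff]
    have h₁ : (φ.eval V ⇨ ψ.eval V ⇨ θ.eval V) ⊓ φ.eval V ≤ ψ.eval V ⇨ θ.eval V := himp_inf_le
    have h₂ : (φ.eval V ⇨ ψ.eval V) ⊓ φ.eval V ≤ ψ.eval V := himp_inf_le
    calc _ ≤ (ψ.eval V ⇨ θ.eval V) ⊓ ψ.eval V :=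
          le_inf ((inf_le_inf_right _ inf_le_left).trans h₁)
            ((inf_le_inf_right _ inf_le_right).trans h₂)
      _ ≤ _ := himp_inf_le
  | andLeft φ ψ => simp [eval]
  | andRight φ ψ => simp [eval]
  | andIntro φ ψ => simp [eval]
  | orLeft φ ψ => simp [eval]
  | orRight φ ψ => simp [eval]
  | orElim φ ψ θ =>
    simp only [eval, himp_eq_top_iff, le_himp_iff, ← sup_himp_distrib]
    exact himp_inf_le
  | exFalso φ => simp [eval]
  | mp _ _ h₁ h₂ => simpa [eval, h₁] using h₂

/-! ### Subalgebras generated by a valuation -/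

section EvalRange

variable {α : Type*} {H : Type*} [HeytingAlgebra H] {K : Type*} [HeytingAlgebra K]

/-- The Heyting subalgebra generated by the values of a valuation. -/
def EvalRange (V : α → H) : Type _ := Set.range fun φ : Formula α => φ.eval V

namespace EvalRange

variable (V : α → H)

instance : Max (EvalRange V) :=
  ⟨fun a b => ⟨a.1 ⊔ b.1, by
    obtain ⟨⟨_, φ, rfl⟩, ⟨_, ψ, rfl⟩⟩ := a, b; exact ⟨φ.or ψ, rfl⟩⟩⟩

instance : Min (EvalRange V) :=
  ⟨fun a b => ⟨a.1 ⊓ b.1, by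
    obtain ⟨⟨_, φ, rfl⟩, ⟨_, ψ, rfl⟩⟩ := a, b; exact ⟨φ.and ψ, rfl⟩⟩⟩

instance : HImp (EvalRange V) :=
  ⟨fun a b => ⟨a.1 ⇨ b.1, by
    obtain ⟨⟨_, φ, rfl⟩, ⟨_, ψ, rfl⟩⟩ := a, b; exact ⟨φ.imp ψ, rfl⟩⟩⟩

instance : Bot (EvalRange V) := ⟨⟨⊥, .bot, rfl⟩⟩

instance : Top (EvalRange V) := ⟨⟨⊤, bot.imp .bot, himp_self⟩⟩

instance : Compl (EvalRange V) :=
  ⟨fun a => ⟨a.1ᶜ, by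
    obtain ⟨_, φ, rfl⟩ := a; exact ⟨φ.imp .bot, himp_bot _⟩⟩⟩

instance : LE (EvalRange V) := ⟨fun a b => a.1 ≤ b.1⟩

instance : LT (EvalRange V) := ⟨fun a b => a.1 < b.1⟩

instance : HeytingAlgebra (EvalRange V) :=
  Function.Injective.heytingAlgebra Subtype.val Subtype.val_injective Iff.rfl Iff.rfl
    (fun _ _ => rfl) (fun _ _ => rfl) rfl rfl (fun _ => rfl) fun _ _ => rfl

/-- The inclusion of the subalgebra generated by a valuation. -/
def incl : HeytingHom (EvalRange V) H where
  toFun := Subtype.val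
  map_sup' _ _ := rfl
  map_inf' _ _ := rfl
  map_bot' := rfl
  map_himp' _ _ := rfl

theorem incl_injective : Function.Injective (incl V) := Subtype.val_injective

/-- The value of a formula, as an element of the generated subalgebra. -/
def mk (φ : Formula α) : EvalRange V := ⟨φ.eval V, φ, rfl⟩

theorem mk_surjective : Function.Surjective (mk V) := by
  rintro ⟨_, φ, rfl⟩
  exact ⟨φ, rfl⟩

variable {V}

theorem mk_eq_mk {φ ψ : Formula α} : mk V φ = mk V ψ ↔ φ.eval V = ψ.eval V := Subtype.ext_iff

/-- If every formula true under `V` is true under `W`, then the algebra generated by `W` is a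
homomorphic image of the algebra generated by `V`. -/
theorem exists_surjective_hom {W : α → K}
    (h : ∀ φ : Formula α, φ.eval V = ⊤ → φ.eval W = ⊤) :
    ∃ f : HeytingHom (EvalRange V) (EvalRange W), Function.Surjective f := by
  have key : ∀ φ ψ : Formula α, mk V φ = mk V ψ → mk W φ = mk W ψ := fun φ ψ e =>
    mk_eq_mk.2 ((eval_iff_eq_top W φ ψ).1 (h _ ((eval_iff_eq_top V φ ψ).2 (mk_eq_mk.1 e))))
  -- By `key`, the choice of a formula representing `a` is immaterial.
  let g : EvalRange V → EvalRange W := fun a => mk W (Function.surjInv (mk_surjective V) a)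
  have hg : ∀ φ, g (mk V φ) = mk W φ := fun φ =>
    key _ _ (Function.surjInv_eq (mk_surjective V) _)
  refine ⟨{ toFun := g, map_sup' := ?_, map_inf' := ?_, map_bot' := hg .bot, map_himp' := ?_ },
    fun b => ?_⟩
  · intro a b
    obtain ⟨φ, rfl⟩ := mk_surjective V a
    obtain ⟨ψ, rfl⟩ := mk_surjective V b
    rw [hg, hg]
    exact hg (φ.or ψ)
  · intro a b
    obtain ⟨φ, rfl⟩ := mk_surjective V a
    obtain ⟨ψ, rfl⟩ := mk_surjective V b
    rw [hg, hg]
    exact hg (φ.and ψ)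
  · intro a b
    obtain ⟨φ, rfl⟩ := mk_surjective V a
    obtain ⟨ψ, rfl⟩ := mk_surjective V b
    rw [hg, hg]
    exact hg (φ.imp ψ)
  · obtain ⟨φ, rfl⟩ := mk_surjective W b
    exact ⟨mk V φ, hg φ⟩

end EvalRange

end EvalRange

/-! ### Cores and their preservation -/

section Core

variable {AP : Type v} {p : AP} {χ : Formula AP} {H : Type*} [HeytingAlgebra H]
  {K : Type*} [HeytingAlgebra K]

theorem semiconj_poly (f : HeytingHom H K) : Function.Semiconj f (poly χ H) (poly χ K) :=
  fun _ => map_eval f _ χ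

theorem core_nonempty : (core p χ H).Nonempty := ⟨_, ⊥, rfl⟩

theorem map_mem_core (f : HeytingHom H K) {a : H} (ha : a ∈ core p χ H) : f a ∈ core p χ K := by
  obtain ⟨b, rfl⟩ := ha
  exact ⟨f b, (((semiconj_poly f).iterate_right _) b).symm⟩

/-- If `χⁿ ↔ χⁿ⁺²` is provable for some `n`, then the polynomial of `χ` is an involution of
the core; otherwise the index is `0` and the core is the whole algebra. In both cases the
iterates at twice the index fix the core pointwise. -/
theorem iterate_poly_of_mem_core (hχ : χ.atoms ⊆ {p}) {a : H} (ha : a ∈ core p χ H) :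
    (poly χ H)^[index p χ] ((poly χ H)^[index p χ] a) = a := by
  by_cases hne : {n : ℕ | IPC ((χ.iter p n).iff (χ.iter p (n + 2)))}.Nonempty
  · have hn : IPC ((χ.iter p (index p χ)).iff (χ.iter p (index p χ + 2))) := Nat.sInf_mem hne
    obtain ⟨b, rfl⟩ := ha
    set n := index p χ
    have h := (eval_iff_eq_top (fun _ => b) _ _).1 (hn.sound fun _ => b)
    rw [eval_iter hχ, eval_iter hχ, add_comm, Function.iterate_add_apply] at h
    -- Core elements have period `2`, hence also period `2n`.
    have hper : Function.IsPeriodicPt (poly χ H) 2 ((poly χ H)^[n] b) := h.symm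
    rw [← Function.iterate_add_apply, ← mul_two]
    exact hper.const_mul n
  · have h0 : index p χ = 0 := by
      rw [index, Set.not_nonempty_iff_eq_empty.1 hne, Nat.sInf_empty]
    rw [h0]
    rfl

/-- An embedding whose image contains the core preserves the core. -/
theorem image_core_eq (hχ : χ.atoms ⊆ {p}) (f : HeytingHom H K)
    (h : core p χ K ⊆ Set.range f) : f '' core p χ H = core p χ K := by
  refine Set.Subset.antisymm ?_ fun a ha => ?_
  · rintro _ ⟨a, ha, rfl⟩
    exact map_mem_core f ha
  · obtain ⟨b, rfl⟩ := h ha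
    -- The preimage `b` of `a` is replaced by `χⁿ(χⁿ(b))`, visibly in the core and still sent to
    -- `a`. A single `χⁿ` could give another core element.
    refine ⟨_, ⟨(poly χ H)^[index p χ] b, rfl⟩, ?_⟩
    rw [((semiconj_poly f).iterate_right _).eq, ((semiconj_poly f).iterate_right _).eq,
      iterate_poly_of_mem_core hχ ha]

/-- The subalgebra of `H` generated by the core of `H`. -/
abbrev CoreGenerated (p : AP) (χ : Formula AP) (H : Type*) [HeytingAlgebra H] : Type _ :=
  EvalRange (Subtype.val : core p χ H → H)

theorem image_core_coreGenerated (hχ : χ.atoms ⊆ {p}) :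
    EvalRange.incl (Subtype.val : core p χ H → H) '' core p χ (CoreGenerated p χ H) =
      core p χ H :=
  image_core_eq hχ _ fun a ha => ⟨EvalRange.mk _ (.atom ⟨a, ha⟩), rfl⟩

/-- `χ`-validity descends along embeddings that preserve the core. -/
theorem ChiValid.of_image_core_eq {f : HeytingHom H K}
    (hcore : f '' core p χ H = core p χ K) {φ : Formula AP} (h : ChiValid p χ H φ) :
    ChiValid p χ K φ := by
  intro V hV
  rw [← hcore] at hV
  choose W hW hWV using hV
  obtain rfl : (fun q => f (W q)) = V := funext hWV
  rw [← map_eval, h W hW, map_top]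

end Core

/-! ### Birkhoff's argument for core valuations -/

/-- If `H` shares the `χ`-validities of `C`, then a formula, over any set of atoms, that is refuted
in `H` by a core valuation is refuted by a core valuation in some member of `C`. -/
theorem exists_core_refutation {AP : Type v} [Infinite AP] {p : AP} {χ : Formula AP}
    {C : Set HeytAlg.{u}} {H : Type*} [HeytingAlgebra H]
    (h : ∀ φ ∈ chiLog p χ C, ChiValid p χ H φ) {α : Type*} {V : α → H}
    (hV : ∀ g, V g ∈ core p χ H) {φ : Formula α} (hφ : φ.eval V ≠ ⊤) :
    ∃ B ∈ C, ∃ W : α → B, (∀ g, W g ∈ core p χ B) ∧ φ.eval W ≠ ⊤ := by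
  classical
  have : Finite φ.atoms := φ.finite_atoms
  -- `α` may be larger than `AP`, but the finitely many atoms of `φ` fit into the infinite `AP`.
  let e : φ.atoms ↪ AP :=
    ((Finite.equivFin φ.atoms).toEmbedding.trans Fin.valEmbedding).trans (Infinite.natEmbedding AP)
  obtain ⟨c, hc⟩ := core_nonempty (p := p) (χ := χ) (H := H)
  let r : α → AP := fun g => if hg : g ∈ φ.atoms then e ⟨g, hg⟩ else p
  -- The default `c` must lie in the core, since `χ`-validity constrains the value of every atom.
  let V' : AP → H := fun q => if hq : ∃ g, e g = q then V hq.choose else c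
  have hV' : ∀ q, V' q ∈ core p χ H := by
    intro q
    dsimp only [V']
    split_ifs
    exacts [hV _, hc]
  have hr : ∀ g ∈ φ.atoms, V' (r g) = V g := by
    intro g hg
    have hq : ∃ g', e g' = r g := ⟨⟨g, hg⟩, by simp [r, hg]⟩
    have hg' : hq.choose = ⟨g, hg⟩ := e.injective (by rw [hq.choose_spec]; simp [r, hg])
    simp only [V', dif_pos hq, hg']
  have hnot : φ.rename r ∉ chiLog p χ C := by
    intro hmem
    apply hφ
    rw [← h _ hmem V' hV', eval_rename]
    exact (eval_congr hr).symm
  simp only [chiLog, Set.mem_ofPred_eq, ChiValid, not_forall] at hnot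
  obtain ⟨B, hB, W, hW, hne⟩ := hnot
  exact ⟨B, hB, W ∘ r, fun g => hW _, by rwa [eval_rename] at hne⟩

/-- An algebra generated by a family of core elements belongs to every variety whose
`χ`-validities it shares. -/
theorem evalRange_mem_of_chiLog {AP : Type v} [Infinite AP] {p : AP} {χ : Formula AP}
    {C : Set HeytAlg.{u}} (hC : IsVariety C) {H : Type u} [HeytingAlgebra H]
    (h : ∀ φ ∈ chiLog p χ C, ChiValid p χ H φ) {α : Type u} {V : α → H}
    (hV : ∀ g, V g ∈ core p χ H) : HeytAlg.of (EvalRange V) ∈ C := by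
  -- One factor per refuted formula; if there is none, the product is empty.
  let I : Type u := {φ : Formula α // φ.eval V ≠ ⊤}
  choose B hB W _ hW using fun i : I => exists_core_refutation h hV i.2
  let U : α → HeytAlg.of (∀ i, B i) := fun g i => W i g
  have hP : HeytAlg.of (∀ i, B i) ∈ C := hC.2.2 ⟨I, B, hB, rfl⟩
  have hS : HeytAlg.of (EvalRange U) ∈ C :=
    hC.2.1 ⟨_, hP, EvalRange.incl U, EvalRange.incl_injective U⟩
  have hUV : ∀ φ : Formula α, φ.eval U = ⊤ → φ.eval V = ⊤ := by
    intro φ hφ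
    by_contra hne
    apply hW ⟨φ, hne⟩
    exact (eval_pi (B := fun i => B i) U φ ⟨φ, hne⟩).symm.trans (congrFun hφ _)
  obtain ⟨f, hf⟩ := EvalRange.exists_surjective_hom hUV
  exact hC.1 ⟨_, hS, f, hf⟩

theorem subset_chiClosure {AP : Type v} (p : AP) (χ : Formula AP) (C : Set HeytAlg.{u}) :
    C ⊆ chiClosure p χ C :=
  fun H hH => ⟨H, hH, HeytingHom.id H, Function.injective_id, Set.image_id _⟩

/-- Passing to core superalgebras does not change the `χ`-logic of a class. -/
theorem chiLog_chiClosure {AP : Type v} (p : AP) (χ : Formula AP) (C : Set HeytAlg.{u}) :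
    chiLog p χ (chiClosure p χ C) = chiLog p χ C := by
  refine Set.Subset.antisymm (fun φ h H hH => h H (subset_chiClosure p χ C hH)) ?_
  rintro φ h K ⟨H, hH, f, -, hcore⟩
  exact (h H hH).of_image_core_eq hcore

theorem chiVar_chiLog_chiClosure {AP : Type v} [Infinite AP] {p : AP} {χ : Formula AP}
    (hχ : χ.atoms ⊆ {p}) {C : Set HeytAlg.{u}} (hC : IsVariety C) :
    chiVar p χ (chiLog p χ (chiClosure p χ C)) = chiClosure p χ C := by
  refine Set.Subset.antisymm (fun H h => ?_) fun H hH φ hφ => hφ H hH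
  rw [chiLog_chiClosure] at h
  exact ⟨HeytAlg.of (CoreGenerated p χ H), evalRange_mem_of_chiLog hC h Subtype.prop,
    EvalRange.incl _, EvalRange.incl_injective _, image_core_coreGenerated hχ⟩

end ChiLogic

theorem mainTheorem3 {AP : Type v} [Infinite AP] (p : AP) (χ : ChiLogic.Formula AP)
    (hχ : χ.atoms ⊆ {p}) :
    (∀ X : Set HeytAlg.{u}, ChiLogic.IsChiVariety p χ X →
      ∀ H : HeytAlg.{u},
        H ∈ X ↔ ∀ φ ∈ ChiLogic.chiLog p χ X, ChiLogic.ChiValid p χ H φ) ∧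
    (∀ X : Set HeytAlg.{u}, ChiLogic.IsChiVariety p χ X →
      ChiLogic.chiVar p χ (ChiLogic.chiLog p χ X) = X) := by
  have key : ∀ X : Set HeytAlg.{u}, ChiLogic.IsChiVariety p χ X →
      ChiLogic.chiVar p χ (ChiLogic.chiLog p χ X) = X := by
    rintro _ ⟨C, hC, rfl⟩
    exact ChiLogic.chiVar_chiLog_chiClosure hχ hC
  exact ⟨fun X hX H => (Set.ext_iff.1 (key X hX) H).symm, key⟩
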